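/- Let $R$ be a nonzero commutative ring with identity and let $G$ be a finitely generated free abelian group, with dual $G^{\star}=\mathrm{Hom}(G,\mathbb{Z})$. For a submonoid $M$ of $G$, write $M^{gp}$ for the subgroup of $G$ generated by $M$. A \emph{convex cone} in $G$ is a finitely generated submonoid $M$ of $G$ that is saturated (if $x\in M^{gp}$ and $nx\in M$ for some integer $n\ge 1$, then $x\in M$), whose only invertible element is $0$, and such that $G/M^{gp}$ is torsion free. A \emph{prime ideal} of $M$ is a subset $\mathfrak{p}\subseteq M$ with $M+\mathfrak{p}\subseteq\mathfrak{p}$ such that $M-\mathfrak{p}$ (the complement of $\mathfrak{p}$ in $M$) is a submonoid of $M$. A \emph{fan} in $G$ is a nonempty collection $\triangle$ of convex cones in $G$ such that (1) $P-\mathfrak{p}\in\triangle$ for every $P\in\triangle$ and every prime ideal $\mathfrak{p}$ of $P$, and (2) for all $P,Q\in\triangle$ there are prime ideals $\mathfrak{p}$ of $P$ and $\mathfrak{q}$ of $Q$ with $P\cap Q=P-\mathfrak{p}=Q-\mathfrak{q}$. The fan is \emph{finite} if it is a finite set, and \emph{complete} if $\bigcup_{P\in\triangle}P=G$. For $P\in\triangle$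 put $\check{P}=\{\sigma\in G^{\star}\mid \sigma(x)\ge 0 \text{ for all } x\in P\}$ and $\mathrm{U}_P=\mathrm{Spec}\,R[\check{P}]$, where $R[\check{P}]$ is the monoid algebra. For $Q\subseteq P$ in $\triangle$, the inclusion $R[\check{P}]\subseteq R[\check{Q}]$ induces an open immersion $\mathrm{U}_Q\to\mathrm{U}_P$. The \emph{toric scheme} $X_{\triangle}(R)$ over $R$ is obtained by gluing the schemes $\mathrm{U}_P$ $(P\in\triangle)$ along the open subschemes $\mathrm{U}_{P\cap Q}$ of $\mathrm{U}_P$ and $\mathrm{U}_Q$. \textbf{Theorem.} For every nonzero commutative ring $R$ and every fan $\triangle$ in $G$, the toric scheme $X_{\triangle}(R)$ is proper over $R$ if and only if $\triangle$ is finite and complete. -/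

import Mathlib

open CategoryTheory CategoryTheory.Limits AlgebraicGeometry

universe u

namespace ToricScheme

section Cones

variable {G : Type u} [AddCommGroup G]

/-- `I` is a prime ideal of the (additive) monoid `M`: a subset of `M` with `M + I ⊆ I`
whose complement in `M` is a submonoid of `M`. -/
structure IsPrimeIdeal (M : AddSubmonoid G) (I : Set G) : Prop where
  subset : I ⊆ M
  add_mem : ∀ x ∈ M, ∀ y ∈ I, x + y ∈ I
  zero_notMem : (0 : G) ∉ I
  add_notMem : ∀ x ∈ M, ∀ y ∈ M, x ∉ I → y ∉ I → x + y ∉ I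

/-- The submonoid `M - I` of `M`, for a prime ideal `I` of `M`. -/
def IsPrimeIdeal.compl {M : AddSubmonoid G} {I : Set G} (h : IsPrimeIdeal M I) :
    AddSubmonoid G where
  carrier := (M : Set G) \ I
  zero_mem' := ⟨M.zero_mem, h.zero_notMem⟩
  add_mem' := fun {x y} hx hy =>
    ⟨M.add_mem hx.1 hy.1, h.add_notMem x hx.1 y hy.1 hx.2 hy.2⟩

/-- A submonoid `M` of `G` is saturated if every `x` in the group generated by `M` with
`n x ∈ M` for some `n ≥ 1` lies in `M`. -/
def IsSaturated (M : AddSubmonoid G) : Prop :=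
  ∀ x ∈ AddSubgroup.closure (M : Set G), ∀ n : ℕ, 1 ≤ n → n • x ∈ M → x ∈ M

/-- A convex cone in `G`: a finitely generated saturated submonoid `M` whose only invertible
element is `0` and such that the quotient of `G` by the group generated by `M` is torsion
free. -/
structure IsConvexCone (M : AddSubmonoid G) : Prop where
  fg : M.FG
  saturated : IsSaturated M
  pointed : ∀ x ∈ M, -x ∈ M → x = 0
  torsionFree : IsAddTorsionFree (G ⧸ AddSubgroup.closure (M : Set G))

/-- The dual `{σ ∈ Hom(G, ℤ) | σ(x) ≥ 0 for all x ∈ M}` of a submonoid `M` of `G`. -/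
def dualCone (M : AddSubmonoid G) : AddSubmonoid (Module.Dual ℤ G) where
  carrier := {σ | ∀ x ∈ M, 0 ≤ σ x}
  zero_mem' := fun _ _ => le_rfl
  add_mem' := fun hσ hτ x hx => add_nonneg (hσ x hx) (hτ x hx)

theorem dualCone_anti {M N : AddSubmonoid G} (h : M ≤ N) : dualCone N ≤ dualCone M :=
  fun _ hσ x hx => hσ x (h hx)

variable (G) in
/-- A fan in `G`: a nonempty collection of convex cones in `G`, closed under passing from `P` to
`P - 𝔭` for a prime ideal `𝔭` of `P`, such that the intersection of any two members `P`, `Q` is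
of the form `P - 𝔭` and of the form `Q - 𝔮`. -/
structure Fan where
  cones : Set (AddSubmonoid G)
  nonempty : cones.Nonempty
  isConvexCone : ∀ P ∈ cones, IsConvexCone P
  compl_mem : ∀ P ∈ cones, ∀ (I : Set G) (hI : IsPrimeIdeal P I), hI.compl ∈ cones
  inter : ∀ P ∈ cones, ∀ Q ∈ cones,
    (∃ (I : Set G) (hI : IsPrimeIdeal P I), P ⊓ Q = hI.compl) ∧
    (∃ (J : Set G) (hJ : IsPrimeIdeal Q J), P ⊓ Q = hJ.compl)

/-- The support of a fan: the union of its cones. -/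
def Fan.support (Δ : Fan G) : Set G := ⋃ P ∈ Δ.cones, (P : Set G)

/-- A fan is finite if it consists of finitely many cones. -/
def Fan.IsFinite (Δ : Fan G) : Prop := Δ.cones.Finite

/-- A fan in `G` is complete if its support is all of `G`. -/
def Fan.IsComplete (Δ : Fan G) : Prop := Δ.support = Set.univ

theorem Fan.inf_mem (Δ : Fan G) {P Q : AddSubmonoid G} (hP : P ∈ Δ.cones) (hQ : Q ∈ Δ.cones) :
    P ⊓ Q ∈ Δ.cones := by
  obtain ⟨⟨I, hI, h⟩, -⟩ := Δ.inter P hP Q hQ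
  rw [h]
  exact Δ.compl_mem P hP I hI

/-! ### Linear forms cutting out the submonoids `P - 𝔭` -/

/-- `σ` vanishes on `F` and is positive on the elements of `P` outside `F`. -/
structure Separates (P F : AddSubmonoid G) (σ : Module.Dual ℤ G) : Prop where
  le : F ≤ P
  eq_zero : ∀ x ∈ F, σ x = 0
  pos : ∀ x ∈ P, x ∉ F → 0 < σ x

theorem Separates.mem_dualCone {P F : AddSubmonoid G} {σ : Module.Dual ℤ G}
    (h : Separates P F σ) : σ ∈ dualCone P := fun x hx => by
  by_cases hF : x ∈ F
  · exact (h.eq_zero x hF).ge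
  · exact (h.pos x hx hF).le

theorem Separates.inf {P F F' : AddSubmonoid G} {σ σ' : Module.Dual ℤ G}
    (h : Separates P F σ) (h' : Separates P F' σ') : Separates P (F ⊓ F') (σ + σ') where
  le := inf_le_left.trans h.le
  eq_zero := fun x hx => by simp [h.eq_zero x hx.1, h'.eq_zero x hx.2]
  pos := fun x hx hn => by
    have h1 := h.mem_dualCone x hx
    have h2 := h'.mem_dualCone x hx
    have : x ∉ F ∨ x ∉ F' := by
      by_contra hc
      push Not at hc
      exact hn ⟨hc.1, hc.2⟩
    rw [LinearMap.add_apply]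
    rcases this with h3 | h3
    · have := h.pos x hx h3
      omega
    · have := h'.pos x hx h3
      omega

theorem Separates.exists_add_nsmul_mem {P F : AddSubmonoid G} {σ : Module.Dual ℤ G}
    (h : Separates P F σ) (hP : P.FG) {τ : Module.Dual ℤ G} (hτ : τ ∈ dualCone F) :
    ∃ n : ℕ, τ + n • σ ∈ dualCone P := by
  obtain ⟨S, rfl⟩ := hP
  refine ⟨∑ s ∈ S, (τ s).natAbs, fun x hx => ?_⟩
  induction hx using AddSubmonoid.closure_induction with
  | zero => simp
  | add x y _ _ hx hy => rw [map_add]; exact add_nonneg hx hy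
  | mem s hs =>
    have hs' := AddSubmonoid.subset_closure hs
    simp only [LinearMap.add_apply, LinearMap.smul_apply]
    by_cases hF : s ∈ F
    · simpa [h.eq_zero s hF] using hτ s hF
    · have h1 := h.pos s hs' hF
      have h2 : (τ s).natAbs ≤ ∑ s ∈ S, (τ s).natAbs :=
        Finset.single_le_sum (f := fun s => (τ s).natAbs) (fun _ _ => Nat.zero_le _) hs
      have h3 : ((τ s).natAbs : ℤ) ≤ ((∑ s ∈ S, (τ s).natAbs : ℕ) : ℤ) := by exact_mod_cast h2
      rw [nsmul_eq_mul]
      nlinarith [Int.natCast_natAbs (τ s), neg_abs_le (τ s)]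

theorem exists_nsmul_mem_closure_or [Module.Free ℤ G] {ι : Type*} (t : Finset ι) :
    ∀ (v : ι → G) (x : G), (∃ n : ℕ, 0 < n ∧ n • x ∈ AddSubmonoid.closure (v '' t)) ∨
      ∃ f : Module.Dual ℤ G, (∀ i ∈ t, 0 ≤ f (v i)) ∧ f x < 0 := by
  classical
  induction t using Finset.induction_on with
  | empty =>
    intro v x
    by_cases hx : x = 0
    · exact Or.inl ⟨1, one_pos, by simp [hx]⟩
    · right
      obtain ⟨f, hf⟩ : ∃ f : Module.Dual ℤ G, f x ≠ 0 := by
        by_contra hc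
        push Not at hc
        exact hx ((Module.forall_dual_apply_eq_zero_iff ℤ x).1 hc)
      rcases lt_or_gt_of_ne hf with h | h
      · exact ⟨f, by simp, h⟩
      · exact ⟨-f, by simp, by simpa using h⟩
  | insert a t ha ih =>
    intro v x
    rcases ih v x with ⟨n, hn, h⟩ | ⟨f, hf, hx⟩
    · exact Or.inl ⟨n, hn, AddSubmonoid.closure_mono (Set.image_mono (by simp)) h⟩
    by_cases hs : 0 ≤ f (v a)
    · right
      refine ⟨f, fun i hi => ?_, hx⟩
      rcases Finset.mem_insert.1 hi with rfl | hi
      · exact hs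
      · exact hf i hi
    push Not at hs
    obtain ⟨c, hc⟩ := Int.eq_ofNat_of_zero_le (a := -f (v a)) (by omega)
    obtain ⟨d, hd⟩ := Int.eq_ofNat_of_zero_le (a := -f x) (by omega)
    rcases ih (fun i => (-f (v a)) • v i + f (v i) • v a) ((-f (v a)) • x + f x • v a) with
      ⟨n, hn, h⟩ | ⟨g, hg, hx'⟩
    · left
      have hva : v a ∈ AddSubmonoid.closure (v '' ((insert a t : Finset ι) : Set ι)) :=
        AddSubmonoid.subset_closure ⟨a, by simp, rfl⟩
      have hle : AddSubmonoid.closure ((fun i => (-f (v a)) • v i + f (v i) • v a) '' t) ≤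
          AddSubmonoid.closure (v '' ((insert a t : Finset ι) : Set ι)) := by
        rw [AddSubmonoid.closure_le]
        rintro _ ⟨i, hi, rfl⟩
        obtain ⟨e, he⟩ := Int.eq_ofNat_of_zero_le (hf i hi)
        simp only [hc, he, natCast_zsmul]
        have hvi : v i ∈ AddSubmonoid.closure (v '' ((insert a t : Finset ι) : Set ι)) :=
          AddSubmonoid.subset_closure ⟨i, Finset.mem_coe.2 (Finset.mem_insert_of_mem hi), rfl⟩
        exact add_mem (nsmul_mem hvi _) (nsmul_mem hva _)
      refine ⟨n * c, Nat.mul_pos hn (by omega), ?_⟩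
      have h2 := add_mem (hle h) (nsmul_mem hva (n * d))
      convert h2 using 1
      have hfx : f x = -(d : ℤ) := by omega
      rw [hc, hfx, smul_add, neg_smul, smul_neg, natCast_zsmul, natCast_zsmul, mul_smul, mul_smul]
      abel
    · right
      refine ⟨(-f (v a)) • g + (g (v a)) • f, fun i hi => ?_, ?_⟩
      · rcases Finset.mem_insert.1 hi with rfl | hi
        · simp [mul_comm]
        · have := hg i hi
          simp only [map_add, map_smul, smul_eq_mul] at this
          simp only [LinearMap.add_apply, LinearMap.smul_apply, smul_eq_mul]
          linarith
      · simp only [map_add, map_smul, smul_eq_mul] at hx'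
        simp only [LinearMap.add_apply, LinearMap.smul_apply, smul_eq_mul]
        linarith

theorem exists_separates_compl [Module.Free ℤ G] {P : AddSubmonoid G} (hP : P.FG)
    {I : Set G} (hI : IsPrimeIdeal P I) : ∃ σ, Separates P hI.compl σ := by
  classical
  have hleft : ∀ x ∈ P, ∀ y ∈ P, x + y ∈ hI.compl → x ∈ hI.compl := fun x hx y hy h =>
    ⟨hx, fun hxI => h.2 (by rw [add_comm]; exact hI.add_mem y hy x hxI)⟩
  obtain ⟨S, hS⟩ := hP
  have hSP : ∀ s ∈ S, s ∈ P := fun s hs => hS ▸ AddSubmonoid.subset_closure hs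
  have key : ∀ s : G, ∃ f : Module.Dual ℤ G, (∀ y ∈ S, 0 ≤ f y) ∧
      (∀ y ∈ S, y ∈ hI.compl → f y = 0) ∧ (s ∈ S → s ∉ hI.compl → 0 < f s) := by
    intro s
    by_cases hs : s ∈ S ∧ s ∉ hI.compl
    swap
    · exact ⟨0, by simp, by simp, fun h1 h2 => absurd ⟨h1, h2⟩ hs⟩
    obtain ⟨hs, hsF⟩ := hs
    rcases exists_nsmul_mem_closure_or
      (S ∪ (S.filter (fun y => y ∈ hI.compl)).image (fun y => -y)) id (-s) with
      ⟨n, hn, h⟩ | ⟨f, hf, hx⟩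
    · exfalso
      have hsub : ∀ z ∈ AddSubmonoid.closure (id ''
          ((S ∪ (S.filter (fun y => y ∈ hI.compl)).image (fun y => -y) : Finset G) : Set G)),
          ∃ q ∈ hI.compl, z + q ∈ P := by
        intro z hz
        induction hz using AddSubmonoid.closure_induction with
        | zero => exact ⟨0, zero_mem _, by simp⟩
        | add x y _ _ hx hy =>
          obtain ⟨q, hq, h1⟩ := hx
          obtain ⟨r, hr, h2⟩ := hy
          refine ⟨q + r, add_mem hq hr, ?_⟩
          rw [add_add_add_comm]
          exact add_mem h1 h2
        | mem y hy =>
          simp only [Set.image_id, Finset.mem_coe, Finset.mem_union, Finset.mem_image,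
            Finset.mem_filter] at hy
          rcases hy with hy | ⟨w, ⟨-, hw⟩, rfl⟩
          · exact ⟨0, zero_mem _, by simpa using hSP y hy⟩
          · exact ⟨w, hw, by simp⟩
      obtain ⟨q, hq, hp⟩ := hsub _ h
      obtain ⟨m, rfl⟩ := Nat.exists_eq_succ_of_ne_zero hn.ne'
      refine hsF (hleft s (hSP s hs) (m • s + (m.succ • -s + q))
        (add_mem (nsmul_mem (hSP s hs) m) hp) ?_)
      convert hq using 1
      rw [Nat.succ_eq_add_one, add_smul, one_smul, smul_neg]
      abel
    · have h0 : ∀ y ∈ S, 0 ≤ f y := fun y hy => hf y (Finset.mem_union_left _ hy)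
      refine ⟨f, h0, fun y hy hyF => ?_, fun _ _ => by simpa using hx⟩
      have h1 := hf (-y) (Finset.mem_union_right _
        (Finset.mem_image_of_mem _ (Finset.mem_filter.2 ⟨hy, hyF⟩)))
      have h2 := h0 y hy
      simp only [id, map_neg] at h1
      omega
  choose f hf0 hfF hfpos using key
  have hmain : ∀ x ∈ P, 0 ≤ (∑ s ∈ S, f s) x ∧ (x ∈ hI.compl → (∑ s ∈ S, f s) x = 0) ∧
      (x ∉ hI.compl → 0 < (∑ s ∈ S, f s) x) := by
    intro x hx
    rw [← hS] at hx
    induction hx using AddSubmonoid.closure_induction with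
    | zero => exact ⟨by simp, by simp, fun h => absurd (zero_mem _) h⟩
    | mem y hy =>
      simp only [LinearMap.sum_apply]
      exact ⟨Finset.sum_nonneg fun s _ => hf0 s y hy,
        fun h => Finset.sum_eq_zero fun s _ => hfF s y hy h,
        fun h => Finset.sum_pos' (fun s _ => hf0 s y hy) ⟨y, hy, hfpos y hy h⟩⟩
    | add x y hx hy ihx ihy =>
      rw [hS] at hx hy
      rw [map_add]
      refine ⟨add_nonneg ihx.1 ihy.1, fun h => ?_, fun h => ?_⟩
      · rw [ihx.2.1 (hleft x hx y hy h), ihy.2.1 (hleft y hy x hx (by rwa [add_comm])), add_zero]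
      · have : x ∉ hI.compl ∨ y ∉ hI.compl := by
          by_contra hc
          push Not at hc
          exact h (add_mem hc.1 hc.2)
        rcases this with h3 | h3
        · exact add_pos_of_pos_of_nonneg (ihx.2.2 h3) ihy.1
        · exact add_pos_of_nonneg_of_pos ihx.1 (ihy.2.2 h3)
  exact ⟨∑ s ∈ S, f s, fun x hx => hx.1, fun x hx => (hmain x hx.1).2.1 hx,
    fun x hx => (hmain x hx).2.2⟩

theorem Fan.exists_separates [Module.Free ℤ G] (Δ : Fan G) {P Q : AddSubmonoid G}
    (hP : P ∈ Δ.cones) (hQ : Q ∈ Δ.cones) (h : Q ≤ P) : ∃ σ, Separates P Q σ := by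
  obtain ⟨⟨I, hI, hPQ⟩, -⟩ := Δ.inter P hP Q hQ
  obtain ⟨σ, hσ⟩ := exists_separates_compl (Δ.isConvexCone P hP).fg hI
  rw [← hPQ, inf_eq_right.2 h] at hσ
  exact ⟨σ, hσ⟩

end Cones

section Schemes

variable (R : Type u) [CommRing R] {G : Type u} [AddCommGroup G]

/-- The inclusion `R[P^∨] → R[Q^∨]` for submonoids `Q ⊆ P`. -/
noncomputable def chartRingHom {P Q : AddSubmonoid G} (h : Q ≤ P) :
    AddMonoidAlgebra R (dualCone P) →+* AddMonoidAlgebra R (dualCone Q) :=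
  AddMonoidAlgebra.mapDomainRingHom R (AddSubmonoid.inclusion (dualCone_anti h))

theorem Separates.isLocalizationAway {P F : AddSubmonoid G} {σ : Module.Dual ℤ G}
    (h : Separates P F σ) (hP : P.FG) :
    let _ := (chartRingHom R h.le).toAlgebra
    IsLocalization.Away (AddMonoidAlgebra.single (⟨σ, h.mem_dualCone⟩ : dualCone P) (1 : R))
      (AddMonoidAlgebra R (dualCone F)) := by
  let _ := (chartRingHom R h.le).toAlgebra
  have hσF : σ ∈ dualCone F := dualCone_anti h.le h.mem_dualCone
  have hσF' : -σ ∈ dualCone F := fun x hx => by simp [h.eq_zero x hx]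
  have hsingle : ∀ (τ : dualCone P) (r : R),
      algebraMap (AddMonoidAlgebra R (dualCone P)) (AddMonoidAlgebra R (dualCone F))
        (AddMonoidAlgebra.single τ r) =
      AddMonoidAlgebra.single (AddSubmonoid.inclusion (dualCone_anti h.le) τ) r := fun τ r => by
    change chartRingHom R h.le _ = _
    simp [chartRingHom]
  have hinj : Function.Injective
      (algebraMap (AddMonoidAlgebra R (dualCone P)) (AddMonoidAlgebra R (dualCone F))) :=
    AddMonoidAlgebra.mapDomain_injective (AddSubmonoid.inclusion_injective (dualCone_anti h.le))
  refine IsLocalization.Away.mk _ ?_ (fun z => ?_) (fun a b hab => ⟨0, by rw [hinj hab]⟩)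
  · rw [hsingle]
    refine IsUnit.of_mul_eq_one (AddMonoidAlgebra.single (⟨-σ, hσF'⟩ : dualCone F) (1 : R)) ?_
    rw [AddMonoidAlgebra.single_mul_single, AddMonoidAlgebra.one_def, mul_one]
    congr 1
    ext1
    simp
  · induction z using AddMonoidAlgebra.induction_linear with
    | zero => exact ⟨0, 0, by simp⟩
    | add x y hx hy =>
      obtain ⟨n, a, ha⟩ := hx
      obtain ⟨m, b, hb⟩ := hy
      refine ⟨n + m, a * (AddMonoidAlgebra.single ⟨σ, h.mem_dualCone⟩ 1) ^ m +
        b * (AddMonoidAlgebra.single ⟨σ, h.mem_dualCone⟩ 1) ^ n, ?_⟩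
      rw [map_add, map_mul, map_mul, ← ha, ← hb, map_pow, map_pow]
      ring
    | single τ r =>
      obtain ⟨n, hn⟩ := h.exists_add_nsmul_mem hP τ.2
      refine ⟨n, AddMonoidAlgebra.single ⟨_, hn⟩ r, ?_⟩
      rw [hsingle, hsingle, AddMonoidAlgebra.single_pow, AddMonoidAlgebra.single_mul_single,
        one_pow, mul_one]
      congr 1

/-- The affine charts `U_P = Spec R[P^∨]` for `P` in the fan `Δ`, with the morphisms
`U_Q ⟶ U_P` for `Q ⊆ P`. -/
noncomputable def Fan.charts (Δ : Fan G) : Δ.cones ⥤ Scheme.{u} where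
  obj P := Spec (CommRingCat.of (AddMonoidAlgebra R (dualCone P.1)))
  map {Q P} f := Spec.map (CommRingCat.ofHom
    (chartRingHom R (show Q.1 ≤ P.1 from leOfHom f)))
  map_id P := by
    rw [← Spec.map_id]
    congr 1
    exact congrArg CommRingCat.ofHom (AddMonoidAlgebra.mapDomainRingHom_id (R := R))
  map_comp f g := by
    rw [← Spec.map_comp, ← CommRingCat.ofHom_comp]
    congr 2
    rw [chartRingHom, chartRingHom, chartRingHom, ← AddMonoidAlgebra.mapDomainRingHom_comp]
    rfl

theorem Fan.range_charts_map (Δ : Fan G) {Q P : Δ.cones} (f : Q ⟶ P) {σ : Module.Dual ℤ G}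
    (hσ : Separates P.1 Q.1 σ) :
    Set.range ((Δ.charts R).map f) = ((PrimeSpectrum.basicOpen
      (AddMonoidAlgebra.single (⟨σ, hσ.mem_dualCone⟩ : dualCone P.1) (1 : R)) :
        TopologicalSpace.Opens _) : Set (PrimeSpectrum _)) := by
  let _ := (chartRingHom R hσ.le).toAlgebra
  have := hσ.isLocalizationAway R (Δ.isConvexCone P.1 P.2).fg
  exact PrimeSpectrum.localization_away_comap_range (AddMonoidAlgebra R (dualCone Q.1))
    (AddMonoidAlgebra.single (⟨σ, hσ.mem_dualCone⟩ : dualCone P.1) (1 : R))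

variable [Module.Free ℤ G]

instance Fan.isOpenImmersion_charts_map (Δ : Fan G) {Q P : Δ.cones} (f : Q ⟶ P) :
    IsOpenImmersion ((Δ.charts R).map f) := by
  have hle : Q.1 ≤ P.1 := leOfHom f
  obtain ⟨σ, hσ⟩ := Δ.exists_separates P.2 Q.2 hle
  let _ := (chartRingHom R hle).toAlgebra
  have := hσ.isLocalizationAway R (Δ.isConvexCone P.1 P.2).fg
  exact IsOpenImmersion.of_isLocalization
    (AddMonoidAlgebra.single (⟨σ, hσ.mem_dualCone⟩ : dualCone P.1) (1 : R))

instance Fan.isLocallyDirected_charts (Δ : Fan G) :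
    (Δ.charts R ⋙ Scheme.forget).IsLocallyDirected where
  cond {Q Q' P} f f' x x' hx := by
    obtain ⟨σ, hσ⟩ := Δ.exists_separates P.2 Q.2 (leOfHom f)
    obtain ⟨σ', hσ'⟩ := Δ.exists_separates P.2 Q'.2 (leOfHom f')
    let L : Δ.cones := ⟨Q.1 ⊓ Q'.1, Δ.inf_mem Q.2 Q'.2⟩
    let g : L ⟶ Q := homOfLE (show Q.1 ⊓ Q'.1 ≤ Q.1 from inf_le_left)
    let g' : L ⟶ Q' := homOfLE (show Q.1 ⊓ Q'.1 ≤ Q'.1 from inf_le_right)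
    have hx1 : (Δ.charts R).map f x = (Δ.charts R).map f' x' := hx
    have h1 : (Δ.charts R).map f x ∈ Set.range ((Δ.charts R).map f) := ⟨x, rfl⟩
    have h2 : (Δ.charts R).map f x ∈ Set.range ((Δ.charts R).map f') := ⟨x', hx1.symm⟩
    have h3 : (Δ.charts R).map f x ∈ Set.range ((Δ.charts R).map (g ≫ f)) := by
      rw [Δ.range_charts_map R _ hσ] at h1
      rw [Δ.range_charts_map R _ hσ'] at h2
      rw [Δ.range_charts_map R (g ≫ f) (hσ.inf hσ')]
      have h4 : (AddMonoidAlgebra.single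
          (⟨σ + σ', (hσ.inf hσ').mem_dualCone⟩ : dualCone P.1) (1 : R)) =
          AddMonoidAlgebra.single ⟨σ, hσ.mem_dualCone⟩ 1 *
          AddMonoidAlgebra.single ⟨σ', hσ'.mem_dualCone⟩ 1 := by
        rw [AddMonoidAlgebra.single_mul_single, mul_one]
        rfl
      rw [h4, PrimeSpectrum.basicOpen_mul]
      exact ⟨h1, h2⟩
    obtain ⟨y, hy⟩ := h3
    refine ⟨L, g, g', y, ?_, ?_⟩
    · apply ((Δ.charts R).map f).isOpenEmbedding.injective
      change ((Δ.charts R).map f) ((Δ.charts R).map g y) = _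
      rw [← hy, Functor.map_comp, Scheme.Hom.comp_apply]
    · apply ((Δ.charts R).map f').isOpenEmbedding.injective
      change ((Δ.charts R).map f') ((Δ.charts R).map g' y) = _
      rw [← hx1, ← hy, ← Scheme.Hom.comp_apply, ← Functor.map_comp]
      rfl

/-- The toric scheme of the fan `Δ` over `R`: the gluing of the affine schemes
`U_P = Spec R[P^∨]`, `P ∈ Δ`, along the open subschemes `U_{P ∩ Q}` of `U_P` and `U_Q`. It is the
colimit of the diagram of the `U_P`; since all transition maps are open immersions and
`U_Q ∩ U_{Q'} = U_{Q ∩ Q'}` inside `U_P` for `Q, Q' ⊆ P`, the `U_P` form an open cover of it. -/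
noncomputable abbrev toricScheme (Δ : Fan G) : Scheme.{u} := colimit (Δ.charts R)

/-- The open immersion of the chart `U_P` into the toric scheme. -/
noncomputable abbrev toricChart (Δ : Fan G) (P : Δ.cones) :
    (Δ.charts R).obj P ⟶ toricScheme R Δ := colimit.ι (Δ.charts R) P

theorem isOpenImmersion_toricChart (Δ : Fan G) (P : Δ.cones) :
    IsOpenImmersion (toricChart R Δ P) := inferInstance

/-- The charts cover the toric scheme. -/
theorem toricChart_jointly_surjective (Δ : Fan G) (x : toricScheme R Δ) :
    ∃ (P : Δ.cones) (y : (Δ.charts R).obj P), toricChart R Δ P y = x :=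
  Scheme.IsLocallyDirected.ι_jointly_surjective (Δ.charts R) x

/-- In the toric scheme, `U_P ∩ U_Q = U_{P ∩ Q}`. -/
theorem range_toricChart_inter (Δ : Fan G) (P Q : Δ.cones) :
    Set.range (toricChart R Δ P) ∩ Set.range (toricChart R Δ Q) =
      Set.range (toricChart R Δ ⟨P.1 ⊓ Q.1, Δ.inf_mem P.2 Q.2⟩) := by
  have hw : ∀ {K L : Δ.cones} (f : K ⟶ L) (z : (Δ.charts R).obj K),
      toricChart R Δ L ((Δ.charts R).map f z) = toricChart R Δ K z := fun f z => by
    rw [← Scheme.Hom.comp_apply, colimit.w]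
  let L : Δ.cones := ⟨P.1 ⊓ Q.1, Δ.inf_mem P.2 Q.2⟩
  ext x
  constructor
  · rintro ⟨⟨y, rfl⟩, y', hy'⟩
    obtain ⟨K, f, f', z, rfl, rfl⟩ :=
      (Scheme.IsLocallyDirected.ι_eq_ι_iff (Δ.charts R)).1 hy'.symm
    let g : K ⟶ L := homOfLE (show K.1 ≤ P.1 ⊓ Q.1 from le_inf (leOfHom f) (leOfHom f'))
    exact ⟨(Δ.charts R).map g z, by rw [hw f z]; exact hw g z⟩
  · rintro ⟨z, rfl⟩
    let g : L ⟶ P := homOfLE (show P.1 ⊓ Q.1 ≤ P.1 from inf_le_left)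
    let g' : L ⟶ Q := homOfLE (show P.1 ⊓ Q.1 ≤ Q.1 from inf_le_right)
    exact ⟨⟨_, hw g z⟩, ⟨_, hw g' z⟩⟩

/-- The structure morphism of the toric scheme to `Spec R`, given on `U_P = Spec R[P^∨]` by the
inclusion of `R` in `R[P^∨]`. -/
noncomputable def toricSchemeToSpec (Δ : Fan G) : toricScheme R Δ ⟶ Spec (CommRingCat.of R) :=
  colimit.desc (Δ.charts R)
    { pt := Spec (CommRingCat.of R)
      ι :=
        { app := fun P => Spec.map (CommRingCat.ofHom
            (algebraMap R (AddMonoidAlgebra R (dualCone P.1))))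
          naturality := fun Q P f => by
            change Spec.map _ ≫ Spec.map _ = Spec.map _ ≫ 𝟙 _
            rw [Category.comp_id, ← Spec.map_comp, ← CommRingCat.ofHom_comp]
            congr 2
            exact AddMonoidAlgebra.mapDomainRingHom_comp_algebraMap .. } }

end Schemes

end ToricScheme

/-!
The scheme is studied through its charts `U_P = Spec R[P^∨]`; a morphism from the spectrum of a local
ring to it is a ring homomorphism out of some `R[P^∨]` (`exists_eq_SpecMap_affineChart`), so that
both directions reduce to convex geometry over `ℤ` by way of the valuative criterion.

Suppose that the fan is finite and complete. Finiteness of the fan and Gordan's lemma give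
quasi-compactness and finite type. Uniqueness of lifts along a valuation ring `O ⊆ K` follows from
`(P ∩ Q)^∨ = P^∨ + Q^∨`, which is the separation lemma for cones. For existence, take the smallest
`P` whose chart contains the given `K`-point; there the characters `σ ∈ P^∨` outside `P^⊥` vanish,
and those in `P^⊥` have valuations in an arbitrary ordered group. A lift exists in `U_Q` for `Q ⊇ P`
unless some `τ ∈ Q^∨ ∩ P^⊥` has a value outside `O`. If such a `τ` existed for every `Q ⊇ P`, these
finitely many forms would generate a semigroup not containing `0`, so by Farkas' lemma they would
all be negative at some lattice point `x ∈ G` (`exists_forall_apply_neg`). Moving `x` far in an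
interior direction of `P` puts it in one of the cones `Q ⊇ P`, without changing the values of the
forms in `P^⊥`, and this is a contradiction (`Fan.exists_le_forall_notMem`). The argument treats
value groups of all ranks at once.

Conversely, over a residue field of `R` each chart `U_P` has a distinguished point which lies in
`U_Q` only if `P ⊆ Q`; as a cone has finitely many faces, quasi-compactness makes the fan finite
(`Fan.isFinite_of_quasiCompact`). For `x ∈ G`, the limit of the one-parameter subgroup
`σ ↦ X ^ σ(x)` in a Laurent series field lies in some `U_P`, whence `x ∈ P` by biduality
(`Fan.isComplete_of_existence`).
-/

namespace ToricScheme

/-! ### Faces and duals of cones -/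

section Cones

variable {G : Type u} [AddCommGroup G]

theorem IsPrimeIdeal.mem_compl_of_add_mem {M : AddSubmonoid G} {I : Set G} (hI : IsPrimeIdeal M I)
    {x y : G} (hx : x ∈ M) (hy : y ∈ M) (h : x + y ∈ hI.compl) : x ∈ hI.compl :=
  ⟨hx, fun hxI => h.2 (by rw [add_comm]; exact hI.add_mem y hy x hxI)⟩

theorem IsPrimeIdeal.of_mem_dualCone {P : AddSubmonoid G} {σ : Module.Dual ℤ G}
    (hσ : σ ∈ dualCone P) : IsPrimeIdeal P {x | x ∈ P ∧ 0 < σ x} where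
  subset := fun _ hx => hx.1
  add_mem := fun x hx y hy => ⟨P.add_mem hx hy.1, by
    rw [map_add]; exact add_pos_of_nonneg_of_pos (hσ x hx) hy.2⟩
  zero_notMem := by simp
  add_notMem := fun x hx y hy hxI hyI h => by
    have h1 : ¬ 0 < σ x := fun h => hxI ⟨hx, h⟩
    have h2 : ¬ 0 < σ y := fun h => hyI ⟨hy, h⟩
    have h3 := h.2
    rw [map_add] at h3
    omega

theorem IsPrimeIdeal.separates_of_mem_dualCone {P : AddSubmonoid G} {σ : Module.Dual ℤ G}
    (hσ : σ ∈ dualCone P) : Separates P (IsPrimeIdeal.of_mem_dualCone hσ).compl σ where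
  le := fun _ hx => hx.1
  eq_zero := fun x hx => le_antisymm (not_lt.1 fun h => hx.2 ⟨hx.1, h⟩) (hσ x hx.1)
  pos := fun x hx hn => by
    by_contra h
    exact hn ⟨hx, fun h' => h h'.2⟩

theorem Fan.mem_of_add_mem (Δ : Fan G) {P Q : AddSubmonoid G} (hP : P ∈ Δ.cones)
    (hQ : Q ∈ Δ.cones) {x y : G} (hx : x ∈ P) (hy : y ∈ P) (h : x + y ∈ Q) : x ∈ Q := by
  obtain ⟨⟨I, hI, hPQ⟩, -⟩ := Δ.inter P hP Q hQ
  have h1 : x ∈ P ⊓ Q := by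
    rw [hPQ]
    exact hI.mem_compl_of_add_mem hx hy (hPQ ▸ ⟨add_mem hx hy, h⟩)
  exact h1.2

theorem Fan.bot_mem (Δ : Fan G) : (⊥ : AddSubmonoid G) ∈ Δ.cones := by
  obtain ⟨P, hP⟩ := Δ.nonempty
  have hI : IsPrimeIdeal P {x | x ∈ P ∧ x ≠ 0} :=
    { subset := fun _ hx => hx.1
      add_mem := fun x hx y hy => ⟨P.add_mem hx hy.1, fun h => hy.2
        ((Δ.isConvexCone P hP).pointed y hy.1 (by rwa [← eq_neg_of_add_eq_zero_left h]))⟩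
      zero_notMem := by simp
      add_notMem := fun x hx y hy hxI hyI h => by
        have h1 : x = 0 := by_contra fun h => hxI ⟨hx, h⟩
        have h2 : y = 0 := by_contra fun h => hyI ⟨hy, h⟩
        exact h.2 (by rw [h1, h2, add_zero]) }
  convert Δ.compl_mem P hP _ hI using 1
  refine le_antisymm bot_le fun x hx => ?_
  exact AddSubmonoid.mem_bot.2 (by_contra fun h => hx.2 ⟨hx.1, h⟩)

theorem IsConvexCone.mem_of_nsmul_mem {P : AddSubmonoid G} (hP : IsConvexCone P) {n : ℕ}
    (hn : 0 < n) {x : G} (hx : n • x ∈ P) : x ∈ P := by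
  refine hP.saturated x ?_ n hn hx
  have := hP.torsionFree
  rw [← QuotientAddGroup.eq_zero_iff]
  refine (nsmul_eq_zero_iff_right hn.ne').1 ?_
  rw [← QuotientAddGroup.mk_nsmul, QuotientAddGroup.eq_zero_iff]
  exact AddSubgroup.subset_closure hx

/-- Biduality: a convex cone is cut out by the linear forms that are nonnegative on it. -/
theorem IsConvexCone.mem_of_forall_dualCone [Module.Free ℤ G] {P : AddSubmonoid G}
    (hP : IsConvexCone P) {x : G} (h : ∀ σ ∈ dualCone P, 0 ≤ σ x) : x ∈ P := by
  obtain ⟨S, hS⟩ := hP.fg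
  rcases exists_nsmul_mem_closure_or S id x with ⟨n, hn, h'⟩ | ⟨f, hf, hx⟩
  · rw [Set.image_id, hS] at h'
    exact hP.mem_of_nsmul_mem hn h'
  · refine absurd (h f fun y hy => ?_) (not_le.2 hx)
    rw [← hS] at hy
    induction hy using AddSubmonoid.closure_induction with
    | zero => simp
    | add a b _ _ ha hb => rw [map_add]; exact add_nonneg ha hb
    | mem s hs => exact hf s hs

/-- An interior lattice point `p` of `P`, namely the sum of a finite set of generators: any cone
of the fan containing `p` contains `P`. -/
theorem Fan.exists_mem_forall_le (Δ : Fan G) {P : AddSubmonoid G} (hP : P ∈ Δ.cones) :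
    ∃ p ∈ P, ∀ Q ∈ Δ.cones, p ∈ Q → P ≤ Q := by
  classical
  obtain ⟨S, hS⟩ := (Δ.isConvexCone P hP).fg
  have hSP : ∀ s ∈ S, s ∈ P := fun s hs => hS ▸ AddSubmonoid.subset_closure hs
  refine ⟨∑ s ∈ S, s, sum_mem hSP, fun Q hQ hp => ?_⟩
  rw [← hS, AddSubmonoid.closure_le]
  intro s hs
  refine Δ.mem_of_add_mem hP hQ (hSP s hs)
    (sum_mem (t := S.erase s) (f := id) fun t ht => hSP t (Finset.mem_of_mem_erase ht)) ?_
  rwa [← Finset.add_sum_erase S (fun s => s) hs] at hp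

/-- A cone of a fan has only finitely many faces in the fan: each is generated by the generators
of the cone lying in it. -/
theorem Fan.finite_setOf_le (Δ : Fan G) {Q : AddSubmonoid G} (hQ : Q ∈ Δ.cones) :
    {P ∈ Δ.cones | P ≤ Q}.Finite := by
  classical
  obtain ⟨S, hS⟩ := (Δ.isConvexCone Q hQ).fg
  have hSQ : ∀ s ∈ S, s ∈ Q := fun s hs => hS ▸ AddSubmonoid.subset_closure hs
  refine (S.powerset.finite_toSet.image
    (fun T : Finset G => AddSubmonoid.closure (T : Set G))).subset ?_
  rintro P ⟨hP, hPQ⟩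
  refine ⟨S.filter (· ∈ P), Finset.mem_coe.2 (Finset.mem_powerset.2 (Finset.filter_subset _ _)),
    le_antisymm ?_ fun x hx => ?_⟩
  · rw [AddSubmonoid.closure_le]
    intro s hs
    exact (Finset.mem_filter.1 hs).2
  · have key : ∀ y ∈ AddSubmonoid.closure (S : Set G), y ∈ P →
        y ∈ AddSubmonoid.closure ((S.filter (· ∈ P) : Finset G) : Set G) := by
      intro y hy
      induction hy using AddSubmonoid.closure_induction with
      | zero => exact fun _ => zero_mem _
      | mem s hs =>
        exact fun h => AddSubmonoid.subset_closure (Finset.mem_coe.2 (Finset.mem_filter.2 ⟨hs, h⟩))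
      | add a b ha hb iha ihb =>
        rw [hS] at ha hb
        intro h
        exact add_mem (iha (Δ.mem_of_add_mem hQ hP ha hb h))
          (ihb (Δ.mem_of_add_mem hQ hP hb ha (by rwa [add_comm])))
    exact key x (hS ▸ hPQ hx) hx

/-- The separation lemma: a linear form vanishing on the common face `P ∩ Q` of two cones of a fan
whose sign is positive on the rest of `P` and negative on the rest of `Q`. It is a linear form
cutting out the largest subgroup of the monoid `P - Q`. -/
theorem Fan.exists_separates_inf [Module.Free ℤ G] (Δ : Fan G) {P Q : AddSubmonoid G}
    (hP : P ∈ Δ.cones) (hQ : Q ∈ Δ.cones) :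
    ∃ σ, Separates P (P ⊓ Q) σ ∧ Separates Q (P ⊓ Q) (-σ) := by
  let N : AddSubmonoid G := Q.map (-AddMonoidHom.id G)
  have hN : ∀ x, x ∈ N ↔ -x ∈ Q := fun x =>
    ⟨by rintro ⟨y, hy, rfl⟩; simpa using hy, fun h => ⟨-x, h, by simp⟩⟩
  have hM : (P ⊔ N).FG := ((Δ.isConvexCone P hP).fg).sup (((Δ.isConvexCone Q hQ).fg).map _)
  have hI : IsPrimeIdeal (P ⊔ N) {x | x ∈ P ⊔ N ∧ -x ∉ P ⊔ N} :=
    { subset := fun _ hx => hx.1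
      add_mem := fun x hx y hy => ⟨add_mem hx hy.1, fun h => hy.2 (by
        have := add_mem hx h
        rwa [neg_add, add_neg_cancel_left] at this)⟩
      zero_notMem := by simp
      add_notMem := fun x hx y hy hxI hyI h => by
        have h1 : -x ∈ P ⊔ N := by_contra fun h => hxI ⟨hx, h⟩
        have h2 : -y ∈ P ⊔ N := by_contra fun h => hyI ⟨hy, h⟩
        exact h.2 (by rw [neg_add]; exact add_mem h1 h2) }
  obtain ⟨σ, hσ⟩ := exists_separates_compl hM hI
  have hcompl : ∀ x, x ∈ hI.compl ↔ x ∈ P ⊔ N ∧ -x ∈ P ⊔ N := fun x =>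
    ⟨fun h => ⟨h.1, by_contra fun h' => h.2 ⟨h.1, h'⟩⟩, fun h => ⟨h.1, fun h' => h'.2 h.2⟩⟩
  -- An element of `P` or of `-Q` that is invertible in `P - Q` lies in `P ∩ Q` up to sign.
  have hinv : ∀ x ∈ P, -x ∈ P ⊔ N → x ∈ Q := by
    intro x hx hnx
    obtain ⟨p, hp, q, hq, h⟩ := AddSubmonoid.mem_sup.1 hnx
    refine Δ.mem_of_add_mem hP hQ hx hp ?_
    have : x + p = -q := by rw [← neg_eq_iff_eq_neg, neg_add, ← h]; abel
    rw [this]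
    exact (hN q).1 hq
  have hinv' : ∀ x ∈ Q, x ∈ P ⊔ N → x ∈ P := by
    intro x hx hnx
    obtain ⟨p, hp, q, hq, h⟩ := AddSubmonoid.mem_sup.1 hnx
    refine Δ.mem_of_add_mem hQ hP hx ((hN q).1 hq) ?_
    rw [← h, add_neg_cancel_right]
    exact hp
  have hPM : ∀ x ∈ P, x ∈ P ⊔ N := fun x hx => (le_sup_left : P ≤ P ⊔ N) hx
  have hQM : ∀ x ∈ Q, -x ∈ P ⊔ N := fun x hx =>
    (le_sup_right : N ≤ P ⊔ N) ((hN _).2 (by rwa [neg_neg]))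
  have h0 : ∀ x ∈ P ⊓ Q, σ x = 0 := fun x hx =>
    hσ.eq_zero x ((hcompl x).2 ⟨hPM x hx.1, hQM x hx.2⟩)
  refine ⟨σ, ⟨inf_le_left, h0, fun x hx hn => ?_⟩, ⟨inf_le_right, fun x hx => ?_, fun x hx hn => ?_⟩⟩
  · exact hσ.pos x (hPM x hx) fun h => hn ⟨hx, hinv x hx ((hcompl x).1 h).2⟩
  · simp [h0 x hx]
  · have := hσ.pos (-x) (hQM x hx) fun h =>
      hn ⟨hinv' x hx (by simpa using ((hcompl _).1 h).2), hx⟩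
    simpa using this

/-- `(P ∩ Q)^∨ = P^∨ + Q^∨` for cones `P`, `Q` of a fan. -/
theorem Fan.exists_add_eq_of_mem_dualCone_inf [Module.Free ℤ G] (Δ : Fan G) {P Q : AddSubmonoid G}
    (hP : P ∈ Δ.cones) (hQ : Q ∈ Δ.cones) {τ : Module.Dual ℤ G} (hτ : τ ∈ dualCone (P ⊓ Q)) :
    ∃ α ∈ dualCone P, ∃ β ∈ dualCone Q, α + β = τ := by
  obtain ⟨σ, h, h'⟩ := Δ.exists_separates_inf hP hQ
  obtain ⟨n, hn⟩ := h.exists_add_nsmul_mem (Δ.isConvexCone P hP).fg hτ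
  exact ⟨_, hn, n • -σ, nsmul_mem h'.mem_dualCone n, by simp⟩

/-- Gordan's lemma. -/
theorem dualCone_fg [Module.Free ℤ G] [Module.Finite ℤ G] {P : AddSubmonoid G} (hP : P.FG) :
    (dualCone P).FG := by
  classical
  obtain ⟨S, hS⟩ := hP
  let b := Module.Free.chooseBasis ℤ (Module.Dual ℤ G)
  let ι := Module.Free.ChooseBasisIndex ℤ (Module.Dual ℤ G)
  -- The linear form with coordinates `u - v`, where `u` and `v` are vectors of natural numbers.
  let e : (ι → ℕ) × (ι → ℕ) × (S → ℕ) →+ Module.Dual ℤ G :=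
    { toFun := fun w => ∑ i, ((w.1 i : ℤ) - w.2.1 i) • b i
      map_zero' := by simp
      map_add' := fun w w' => by
        rw [← Finset.sum_add_distrib]
        refine Finset.sum_congr rfl fun i _ => ?_
        rw [← add_smul]
        congr 1
        simp only [Prod.fst_add, Prod.snd_add, Pi.add_apply, Nat.cast_add]
        ring }
  let f : (ι → ℕ) × (ι → ℕ) × (S → ℕ) →+ (S → ℤ) :=
    { toFun := fun w s => e w s.1
      map_zero' := by ext; simp
      map_add' := fun w w' => by ext; simp }
  let g : (ι → ℕ) × (ι → ℕ) × (S → ℕ) →+ (S → ℤ) :=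
    { toFun := fun w s => w.2.2 s
      map_zero' := by ext; simp
      map_add' := fun w w' => by ext; simp }
  convert (AddSubmonoid.fg_eqLocusM f g).map e using 1
  ext σ
  constructor
  · intro hσ
    have hval : ∀ w : S → ℕ,
        e (fun i => (b.repr σ i).toNat, fun i => (-b.repr σ i).toNat, w) = σ := fun w => by
      change ∑ i, (((b.repr σ i).toNat : ℤ) - ((-b.repr σ i).toNat : ℤ)) • b i = σ
      conv_rhs => rw [← b.sum_repr σ]
      refine Finset.sum_congr rfl fun i _ => ?_
      congr 1
      omega
    refine ⟨(fun i => (b.repr σ i).toNat, fun i => (-b.repr σ i).toNat,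
      fun s => (σ s.1).toNat), ?_, hval _⟩
    change f _ = g _
    ext s
    change e _ s.1 = ((σ s.1).toNat : ℤ)
    rw [hval, Int.toNat_of_nonneg (hσ s.1 (hS ▸ AddSubmonoid.subset_closure s.2))]
  · rintro ⟨w, hw, rfl⟩ x hx
    have hw' : f w = g w := hw
    rw [← hS] at hx
    induction hx using AddSubmonoid.closure_induction with
    | zero => simp
    | add x y _ _ hx hy => rw [map_add]; exact add_nonneg hx hy
    | mem s hs =>
      have : e w s = (w.2.2 ⟨s, hs⟩ : ℤ) := congrFun hw' ⟨s, hs⟩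
      rw [this]
      exact Int.natCast_nonneg _

/-! ### Theorem of the alternative -/

/-- A theorem of the alternative: finitely many linear forms contained in an additive semigroup
not containing `0` are simultaneously negative at some point. -/
theorem exists_forall_apply_neg [Module.Free ℤ G] [Module.Finite ℤ G]
    (T : AddSubsemigroup (Module.Dual ℤ G)) (h0 : (0 : Module.Dual ℤ G) ∉ T)
    (S : Finset (Module.Dual ℤ G)) (hS : ∀ τ ∈ S, τ ∈ T) : ∃ x : G, ∀ τ ∈ S, τ x < 0 := by
  -- Farkas' lemma is applied to the vectors `(τ, 1)` and `(0, 1)` in `G^* × ℤ`.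
  rcases exists_nsmul_mem_closure_or S (fun τ => ((τ, 1) : Module.Dual ℤ G × ℤ)) (0, 1) with
    ⟨n, hn, h⟩ | ⟨f, hf, hx⟩
  · exfalso
    have key : ∀ z ∈ AddSubmonoid.closure
        ((fun τ => ((τ, 1) : Module.Dual ℤ G × ℤ)) '' (S : Set (Module.Dual ℤ G))),
        z = 0 ∨ z.1 ∈ T := by
      intro z hz
      induction hz using AddSubmonoid.closure_induction with
      | zero => exact Or.inl rfl
      | mem z hz =>
        obtain ⟨τ, hτ, rfl⟩ := hz
        exact Or.inr (hS τ hτ)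
      | add z w _ _ hz hw =>
        rcases hz with rfl | hz
        · rwa [zero_add]
        rcases hw with rfl | hw
        · rw [add_zero]; exact Or.inr hz
        exact Or.inr (add_mem hz hw)
    rcases key _ h with h | h
    · have := congrArg Prod.snd h
      simp at this
      omega
    · exact h0 (by simpa using h)
  · obtain ⟨x, hx'⟩ := (Module.evalEquiv ℤ G).surjective
      (f ∘ₗ LinearMap.inl ℤ (Module.Dual ℤ G) ℤ)
    refine ⟨-x, fun τ hτ => ?_⟩
    have h1 := hf τ hτ
    have h2 : f (τ, 0) = τ x := by
      have := LinearMap.congr_fun hx' τ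
      simpa using this.symm
    have h3 : ((τ, 1) : Module.Dual ℤ G × ℤ) = (τ, 0) + (0, 1) := by simp
    rw [h3, map_add, h2] at h1
    rw [map_neg]
    omega

/-- The form in which completeness enters the valuative criterion. If `T` is the set of linear
forms in `P^⊥` that are negative at some "point" of `P^⊥` with values in an ordered group, the
conclusion says that this point lies in the image of a cone `Q ⊇ P`. -/
theorem Fan.exists_le_forall_notMem [Module.Free ℤ G] [Module.Finite ℤ G] (Δ : Fan G)
    (hfin : Δ.IsFinite) (hcomp : Δ.IsComplete) {P : AddSubmonoid G} (hP : P ∈ Δ.cones)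
    (T : AddSubsemigroup (Module.Dual ℤ G)) (h0 : (0 : Module.Dual ℤ G) ∉ T)
    (hT : ∀ τ ∈ T, ∀ x ∈ P, τ x = 0) :
    ∃ Q ∈ Δ.cones, P ≤ Q ∧ ∀ τ ∈ dualCone Q, τ ∉ T := by
  classical
  by_contra! hc
  choose! τ hτ hτT using hc
  obtain ⟨x, hx⟩ := exists_forall_apply_neg T h0
    ((hfin.toFinset.filter (P ≤ ·)).image τ) (by
      intro σ hσ
      simp only [Finset.mem_image, Finset.mem_filter] at hσ
      obtain ⟨Q, ⟨hQ, hPQ⟩, rfl⟩ := hσ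
      exact hτT Q (hfin.mem_toFinset.1 hQ) hPQ)
  obtain ⟨p, hpP, hp⟩ := Δ.exists_mem_forall_le hP
  -- The ray `x + n p` meets some cone `Q` infinitely often, which forces `p ∈ Q`.
  have hmem : ∀ n : ℕ, ∃ Q : Δ.cones, x + n • p ∈ Q.1 := fun n => by
    have : x + n • p ∈ Δ.support := by rw [hcomp]; trivial
    obtain ⟨Q, hQ, h⟩ := Set.mem_iUnion₂.1 this
    exact ⟨⟨Q, hQ⟩, h⟩
  choose c hcm using hmem
  have : Finite Δ.cones := hfin
  obtain ⟨Q, hQinf⟩ := Finite.exists_infinite_fiber c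
  have hbig : ∀ m : ℕ, ∃ n, m < n ∧ x + n • p ∈ Q.1 := fun m => by
    obtain ⟨n, hn, hmn⟩ := (Set.infinite_coe_iff.1 hQinf).exists_gt m
    exact ⟨n, hmn, by have := hcm n; rwa [show c n = Q from hn] at this⟩
  have hpQ : p ∈ Q.1 := by
    refine (Δ.isConvexCone Q.1 Q.2).mem_of_forall_dualCone fun σ hσ => ?_
    by_contra hneg
    obtain ⟨n, hn, hmem⟩ := hbig (σ x).natAbs
    have h1 := hσ _ hmem
    rw [map_add, map_nsmul, nsmul_eq_mul] at h1
    have h2 : ((σ x).natAbs : ℤ) < n := by exact_mod_cast hn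
    nlinarith [Int.natCast_natAbs (σ x), le_abs_self (σ x)]
  have hPQ := hp Q.1 Q.2 hpQ
  obtain ⟨n, -, hmem⟩ := hbig 0
  have h1 := hτ Q.1 Q.2 hPQ _ hmem
  have h2 := hx (τ Q.1) (Finset.mem_image_of_mem _ (Finset.mem_filter.2
    ⟨hfin.mem_toFinset.2 Q.2, hPQ⟩))
  rw [map_add, map_nsmul, hT _ (hτT Q.1 Q.2 hPQ) p hpP] at h1
  simp at h1
  omega

end Cones

section Characters

variable {R : Type u} [CommRing R] {G : Type u} [AddCommGroup G]

/-! ### Points of the charts given by characters -/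

open Classical in
/-- The distinguished point of `U_P` over an `R`-algebra `k`: the character `σ ∈ P^∨` takes the
value `1` if `σ` vanishes on `P` and `0` otherwise. -/
noncomputable def distinguishedPoint (k : Type*) [CommRing k] [Algebra R k] (P : AddSubmonoid G) :
    AddMonoidAlgebra R (dualCone P) →ₐ[R] k :=
  AddMonoidAlgebra.lift R k (dualCone P)
    { toFun := fun σ => if ∀ x ∈ P, σ.toAdd.1 x = 0 then 1 else 0
      map_one' := if_pos fun _ _ => rfl
      map_mul' := fun σ τ => by
        have h : (∀ x ∈ P, (σ * τ).toAdd.1 x = 0) ↔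
            (∀ x ∈ P, σ.toAdd.1 x = 0) ∧ ∀ x ∈ P, τ.toAdd.1 x = 0 := by
          rw [← forall₂_and]
          refine forall₂_congr fun x hx => ?_
          have h1 := σ.toAdd.2 x hx
          have h2 := τ.toAdd.2 x hx
          change σ.toAdd.1 x + τ.toAdd.1 x = 0 ↔ _
          omega
        simp only [h, ite_and]
        split_ifs <;> simp }

open Classical in
theorem distinguishedPoint_single (k : Type*) [CommRing k] [Algebra R k] {P : AddSubmonoid G}
    (σ : dualCone P) : distinguishedPoint k P (AddMonoidAlgebra.single σ (1 : R)) =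
      if ∀ x ∈ P, σ.1 x = 0 then 1 else 0 := by
  rw [distinguishedPoint, AddMonoidAlgebra.lift_single, one_smul]
  rfl

/-- The one-parameter subgroup attached to `x ∈ G`: the `K`-valued point of the torus at which the
character `σ` takes the value `t ^ σ(x)`. -/
noncomputable def oneParameterSubgroup {K : Type*} [Field K] [Algebra R K] (P : AddSubmonoid G)
    {t : K} (ht : t ≠ 0) (x : G) : AddMonoidAlgebra R (dualCone P) →ₐ[R] K :=
  AddMonoidAlgebra.lift R K (dualCone P)
    { toFun := fun σ => t ^ (σ.toAdd.1 x)
      map_one' := zpow_zero t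
      map_mul' := fun _ _ => zpow_add₀ ht _ _ }

theorem oneParameterSubgroup_single {K : Type*} [Field K] [Algebra R K] {P : AddSubmonoid G}
    {t : K} (ht : t ≠ 0) (x : G) (σ : dualCone P) :
    oneParameterSubgroup P ht x (AddMonoidAlgebra.single σ (1 : R)) = t ^ (σ.1 x) := by
  rw [oneParameterSubgroup, AddMonoidAlgebra.lift_single, one_smul]
  rfl

end Characters

section Schemes

variable (R : Type u) [CommRing R] {G : Type u} [AddCommGroup G]

/-! ### Points of the toric scheme with values in a local ring -/

theorem chartRingHom_single {P Q : AddSubmonoid G} (h : Q ≤ P) (τ : dualCone P) (r : R) :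
    chartRingHom R h (AddMonoidAlgebra.single τ r) =
      AddMonoidAlgebra.single (AddSubmonoid.inclusion (dualCone_anti h) τ) r := by
  simp [chartRingHom]

variable [Module.Free ℤ G]

/-- The open immersion of `Spec R[P^∨]` into the toric scheme: `toricChart` with its source written
as the spectrum of a ring. -/
noncomputable def affineChart (Δ : Fan G) (P : Δ.cones) :
    Spec (CommRingCat.of (AddMonoidAlgebra R (dualCone P.1))) ⟶ toricScheme R Δ :=
  toricChart R Δ P

instance isOpenImmersion_affineChart (Δ : Fan G) (P : Δ.cones) :
    IsOpenImmersion (affineChart R Δ P) :=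
  isOpenImmersion_toricChart R Δ P

theorem affineChart_jointly_surjective (Δ : Fan G) (x : toricScheme R Δ) :
    ∃ P : Δ.cones, x ∈ Set.range (affineChart R Δ P) := by
  obtain ⟨P, y, hy⟩ := toricChart_jointly_surjective R Δ x
  exact ⟨P, y, hy⟩

theorem range_affineChart_inter (Δ : Fan G) (P Q : Δ.cones) :
    Set.range (affineChart R Δ P) ∩ Set.range (affineChart R Δ Q) =
      Set.range (affineChart R Δ ⟨P.1 ⊓ Q.1, Δ.inf_mem P.2 Q.2⟩) :=
  range_toricChart_inter R Δ P Q

theorem SpecMap_chartRingHom_affineChart (Δ : Fan G) {P Q : Δ.cones} (h : Q.1 ≤ P.1) :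
    Spec.map (CommRingCat.ofHom (chartRingHom R h)) ≫ affineChart R Δ P = affineChart R Δ Q :=
  colimit.w (Δ.charts R) (homOfLE h : Q ⟶ P)

theorem affineChart_toricSchemeToSpec (Δ : Fan G) (P : Δ.cones) :
    affineChart R Δ P ≫ toricSchemeToSpec R Δ = Spec.map (CommRingCat.ofHom
      (algebraMap R (AddMonoidAlgebra R (dualCone P.1)))) :=
  colimit.ι_desc _ _

variable {R}

/-- A morphism from the spectrum of a local ring whose closed point lands in the chart `U_P`
is given by a ring homomorphism out of `R[P^∨]`. -/
theorem exists_eq_SpecMap_affineChart {Δ : Fan G} {P : Δ.cones} {A : Type u} [CommRing A]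
    [IsLocalRing A] (l : Spec (CommRingCat.of A) ⟶ toricScheme R Δ)
    (h : l (IsLocalRing.closedPoint A) ∈ Set.range (affineChart R Δ P)) :
    ∃ φ : AddMonoidAlgebra R (dualCone P.1) →+* A,
      l = Spec.map (CommRingCat.ofHom φ) ≫ affineChart R Δ P := by
  have h1 : l ⁻¹ᵁ (affineChart R Δ P).opensRange = ⊤ :=
    IsLocalRing.closed_point_mem_iff.mp h
  have h2 : Set.range l ⊆ Set.range (affineChart R Δ P) := by
    rintro _ ⟨x, rfl⟩
    have : x ∈ l ⁻¹ᵁ (affineChart R Δ P).opensRange := by rw [h1]; trivial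
    exact this
  refine ⟨(Spec.preimage (IsOpenImmersion.lift (affineChart R Δ P) l h2)).hom, ?_⟩
  rw [CommRingCat.ofHom_hom, Spec.map_preimage, IsOpenImmersion.lift_fac]

theorem SpecMap_affineChart_injective {Δ : Fan G} {P : Δ.cones} {A : Type u} [CommRing A]
    {φ ψ : AddMonoidAlgebra R (dualCone P.1) →+* A}
    (h : Spec.map (CommRingCat.ofHom φ) ≫ affineChart R Δ P =
      Spec.map (CommRingCat.ofHom ψ) ≫ affineChart R Δ P) : φ = ψ := by
  rw [cancel_mono] at h
  exact congrArg CommRingCat.Hom.hom (Spec.map_injective h)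

/-- Inside `U_P`, the chart of the face of `P` cut out by `σ` is the locus where the character `σ`
does not vanish. -/
theorem affineChart_mem_range_iff {Δ : Fan G} {P F : Δ.cones} {σ : Module.Dual ℤ G}
    (hσ : Separates P.1 F.1 σ) (y : PrimeSpectrum (AddMonoidAlgebra R (dualCone P.1))) :
    affineChart R Δ P y ∈ Set.range (affineChart R Δ F) ↔
      AddMonoidAlgebra.single (⟨σ, hσ.mem_dualCone⟩ : dualCone P.1) (1 : R) ∉ y.asIdeal := by
  have h : y ∈ Set.range ((Δ.charts R).map (homOfLE hσ.le : F ⟶ P)) ↔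
      AddMonoidAlgebra.single (⟨σ, hσ.mem_dualCone⟩ : dualCone P.1) (1 : R) ∉ y.asIdeal := by
    rw [Δ.range_charts_map R _ hσ]
    rfl
  rw [← h]
  have hw : ∀ z, affineChart R Δ P ((Δ.charts R).map (homOfLE hσ.le : F ⟶ P) z) =
      affineChart R Δ F z := fun z => by
    change toricChart R Δ P _ = toricChart R Δ F z
    rw [← Scheme.Hom.comp_apply, colimit.w]
  constructor
  · rintro ⟨z, hz⟩
    exact ⟨z, (affineChart R Δ P).isOpenEmbedding.injective ((hw z).trans hz)⟩
  · rintro ⟨z, rfl⟩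
    exact ⟨z, (hw z).symm⟩

/-! ### Finiteness properties -/

variable (R)

theorem quasiCompact_toricSchemeToSpec {Δ : Fan G} (hfin : Δ.IsFinite) :
    QuasiCompact (toricSchemeToSpec R Δ) := by
  have : Finite (Scheme.IsLocallyDirected.openCover (Δ.charts R)).I₀ := hfin
  have : ∀ i, CompactSpace ((Scheme.IsLocallyDirected.openCover (Δ.charts R)).X i) := fun i =>
    inferInstanceAs (CompactSpace (Spec (CommRingCat.of (AddMonoidAlgebra R (dualCone i.1)))))
  have : CompactSpace (toricScheme R Δ) :=
    Scheme.OpenCover.compactSpace (Scheme.IsLocallyDirected.openCover (Δ.charts R))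
  infer_instance

theorem quasiSeparated_toricSchemeToSpec (Δ : Fan G) :
    QuasiSeparated (toricSchemeToSpec R Δ) := by
  have : QuasiSeparatedSpace (toricScheme R Δ) := by
    refine Scheme.quasiSeparatedSpace_of_isOpenCover (fun P => (affineChart R Δ P).opensRange) ?_
      (fun P => isAffineOpen_opensRange _) fun P Q => ?_
    · refine TopologicalSpace.Opens.ext (Set.eq_univ_of_forall fun x => ?_)
      obtain ⟨P, hP⟩ := affineChart_jointly_surjective R Δ x
      simp only [TopologicalSpace.Opens.coe_iSup, Set.mem_iUnion]
      exact ⟨P, hP⟩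
    · change IsCompact (Set.range (affineChart R Δ P) ∩ Set.range (affineChart R Δ Q))
      rw [range_affineChart_inter]
      exact isCompact_range (affineChart R Δ _).continuous
  infer_instance

theorem locallyOfFiniteType_toricSchemeToSpec [Module.Finite ℤ G] (Δ : Fan G) :
    LocallyOfFiniteType (toricSchemeToSpec R Δ) := by
  have h : ∀ P : Δ.cones, LocallyOfFiniteType (affineChart R Δ P ≫ toricSchemeToSpec R Δ) := by
    intro P
    rw [affineChart_toricSchemeToSpec, HasRingHomProperty.Spec_iff (P := @LocallyOfFiniteType)]
    have : AddMonoid.FG (dualCone P.1) :=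
      (AddMonoid.fg_iff_addSubmonoid_fg _).2 (dualCone_fg (Δ.isConvexCone P.1 P.2).fg)
    exact RingHom.finiteType_algebraMap.2 (AddMonoidAlgebra.finiteType_of_fg R _)
  have : ∀ P, IsAffine ((Scheme.IsLocallyDirected.openCover (Δ.charts R)).X P) := fun P =>
    inferInstanceAs (IsAffine (Spec (CommRingCat.of (AddMonoidAlgebra R (dualCone P.1)))))
  exact (HasRingHomProperty.iff_of_source_openCover (P := @LocallyOfFiniteType)
    (Scheme.IsLocallyDirected.openCover (Δ.charts R))).2 fun P =>
      HasRingHomProperty.appTop (P := @LocallyOfFiniteType) _ (h P)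

/-! ### The valuative criterion -/

variable {R}

theorem exists_algebraMap_comp_eq {A O K : Type*} [CommRing A] [CommRing O] [CommRing K]
    [Algebra O K] (hinj : Function.Injective (algebraMap O K)) (f : A →+* K)
    (hf : ∀ a, f a ∈ (algebraMap O K).range) : ∃ g : A →+* O, (algebraMap O K).comp g = f := by
  let e : O ≃+* (algebraMap O K).range := RingEquiv.ofBijective (algebraMap O K).rangeRestrict
    ⟨fun a b h => hinj (congrArg Subtype.val h), RingHom.rangeRestrict_surjective _⟩
  refine ⟨(e.symm : _ →+* O).comp (f.codRestrict _ hf), RingHom.ext fun a => ?_⟩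
  exact congrArg Subtype.val (e.apply_symm_apply (f.codRestrict _ hf a))

theorem _root_.AddMonoidAlgebra.map_mem_of_single {M K : Type*} [AddMonoid M] [CommRing K]
    (f : AddMonoidAlgebra R M →+* K) (S : Subring K) (h0 : ∀ r : R, f (algebraMap R _ r) ∈ S)
    (h : ∀ m, f (AddMonoidAlgebra.single m 1) ∈ S) (a : AddMonoidAlgebra R M) : f a ∈ S := by
  induction a using AddMonoidAlgebra.induction_linear with
  | zero => simp
  | add x y hx hy => rw [map_add]; exact add_mem hx hy
  | single m r =>
    have : AddMonoidAlgebra.single m r =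
        algebraMap R (AddMonoidAlgebra R M) r * AddMonoidAlgebra.single m 1 := by
      simp [AddMonoidAlgebra.single_mul_single]
    rw [this, map_mul]
    exact mul_mem (h0 r) (h m)

/-- Two lifts with values in charts `U_P` and `U_Q` both come from `U_{P ∩ Q}`, because
`R[(P ∩ Q)^∨]` is generated by `R[P^∨]` and `R[Q^∨]`. -/
theorem toricSchemeToSpec_uniqueness (Δ : Fan G) :
    ValuativeCriterion.Uniqueness (toricSchemeToSpec R Δ) := by
  rintro ⟨O, K, i₁, i₂, ⟨w⟩⟩
  constructor
  rintro ⟨l₁, hl₁, hl₁'⟩ ⟨l₂, hl₂, hl₂'⟩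
  ext : 1
  dsimp only at l₁ l₂ hl₁ hl₁' hl₂ hl₂' ⊢
  obtain ⟨P, hP⟩ := affineChart_jointly_surjective R Δ (l₁ (IsLocalRing.closedPoint O))
  obtain ⟨Q, hQ⟩ := affineChart_jointly_surjective R Δ (l₂ (IsLocalRing.closedPoint O))
  obtain ⟨a, rfl⟩ := exists_eq_SpecMap_affineChart l₁ hP
  obtain ⟨b, rfl⟩ := exists_eq_SpecMap_affineChart l₂ hQ
  let L : Δ.cones := ⟨P.1 ⊓ Q.1, Δ.inf_mem P.2 Q.2⟩
  have hLP : L.1 ≤ P.1 := inf_le_left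
  have hLQ : L.1 ≤ Q.1 := inf_le_right
  have hinj := IsFractionRing.injective O K
  -- The generic point lies in both charts, hence in `U_{P ∩ Q}`.
  have hgen : i₁ (IsLocalRing.closedPoint K) ∈ Set.range (affineChart R Δ L) := by
    rw [← range_affineChart_inter]
    refine ⟨?_, ?_⟩
    · rw [← hl₁]
      exact ⟨_, rfl⟩
    · rw [← hl₂]
      exact ⟨_, rfl⟩
  obtain ⟨c, rfl⟩ := exists_eq_SpecMap_affineChart i₁ hgen
  have hca : (algebraMap O K).comp a = c.comp (chartRingHom R hLP) := by
    apply SpecMap_affineChart_injective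
    simpa [SpecMap_chartRingHom_affineChart] using hl₁
  have hcb : (algebraMap O K).comp b = c.comp (chartRingHom R hLQ) := by
    apply SpecMap_affineChart_injective
    simpa [SpecMap_chartRingHom_affineChart] using hl₂
  -- As `(P ∩ Q)^∨ = P^∨ + Q^∨`, the `K`-valued point `c` of `U_{P ∩ Q}` is an `O`-valued point.
  obtain ⟨d, hd⟩ := exists_algebraMap_comp_eq hinj c (AddMonoidAlgebra.map_mem_of_single c _
    (fun r => ⟨a (algebraMap R _ r), by
      have := RingHom.congr_fun hca (algebraMap R _ r)
      simp only [RingHom.comp_apply] at this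
      rw [this]
      congr 1
      exact RingHom.congr_fun (AddMonoidAlgebra.mapDomainRingHom_comp_algebraMap ..) r⟩)
    (fun τ => by
      obtain ⟨α, hα, β, hβ, h⟩ := Δ.exists_add_eq_of_mem_dualCone_inf P.2 Q.2 τ.2
      have h1 : AddMonoidAlgebra.single τ (1 : R) =
          chartRingHom R hLP (AddMonoidAlgebra.single ⟨α, hα⟩ 1) *
          chartRingHom R hLQ (AddMonoidAlgebra.single ⟨β, hβ⟩ 1) := by
        rw [chartRingHom_single, chartRingHom_single, AddMonoidAlgebra.single_mul_single, one_mul]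
        congr 1
        exact Subtype.ext h.symm
      have h2 := RingHom.congr_fun hca (AddMonoidAlgebra.single ⟨α, hα⟩ 1)
      have h3 := RingHom.congr_fun hcb (AddMonoidAlgebra.single ⟨β, hβ⟩ 1)
      simp only [RingHom.comp_apply] at h2 h3
      rw [h1, map_mul, ← h2, ← h3]
      exact mul_mem ⟨_, rfl⟩ ⟨_, rfl⟩))
  have hda : a = d.comp (chartRingHom R hLP) := RingHom.ext fun x => hinj (by
    have := RingHom.congr_fun hca x
    rw [← hd] at this
    exact this)
  have hdb : b = d.comp (chartRingHom R hLQ) := RingHom.ext fun x => hinj (by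
    have := RingHom.congr_fun hcb x
    rw [← hd] at this
    exact this)
  rw [hda, hdb, CommRingCat.ofHom_comp, CommRingCat.ofHom_comp, Spec.map_comp, Spec.map_comp,
    Category.assoc, Category.assoc, SpecMap_chartRingHom_affineChart,
    SpecMap_chartRingHom_affineChart]

/-- The generic point of the valuation ring gives a character of `P^⊥` for the smallest `P` whose
chart contains it. Composed with the valuation, this is a point of the quotient `G / P^gp` with
values in the value group; it lies in the image of a cone `Q ⊇ P`, and the lift exists in `U_Q`. -/
theorem toricSchemeToSpec_existence [Module.Finite ℤ G] {Δ : Fan G} (hfin : Δ.IsFinite)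
    (hcomp : Δ.IsComplete) : ValuativeCriterion.Existence (toricSchemeToSpec R Δ) := by
  rintro ⟨O, K, i₁, i₂, ⟨w⟩⟩
  dsimp only at i₁ i₂ w ⊢
  have hinj := IsFractionRing.injective O K
  -- The smallest chart containing the generic point.
  have : Finite Δ.cones := hfin
  obtain ⟨P₀, hP₀⟩ := affineChart_jointly_surjective R Δ (i₁ (IsLocalRing.closedPoint K))
  obtain ⟨P, hP⟩ := (Set.toFinite {P : Δ.cones |
    i₁ (IsLocalRing.closedPoint K) ∈ Set.range (affineChart R Δ P)}).exists_minimal ⟨P₀, hP₀⟩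
  obtain ⟨φ, rfl⟩ := exists_eq_SpecMap_affineChart i₁ hP.prop
  -- By minimality, the only characters in `P^∨` not vanishing at it are the invertible ones.
  have hvan : ∀ τ : dualCone P.1, φ (AddMonoidAlgebra.single τ 1) ≠ 0 → ∀ x ∈ P.1, τ.1 x = 0 := by
    intro τ hτ
    have hsep := IsPrimeIdeal.separates_of_mem_dualCone τ.2
    let F : Δ.cones := ⟨_, Δ.compl_mem P.1 P.2 _ (IsPrimeIdeal.of_mem_dualCone τ.2)⟩
    have hF := (affineChart_mem_range_iff (Δ := Δ) (P := P) (F := F) hsep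
      (Spec.map (CommRingCat.ofHom φ) (IsLocalRing.closedPoint K))).2 (by
        intro h
        refine hτ ?_
        have h' : φ (AddMonoidAlgebra.single τ 1) ∈ IsLocalRing.maximalIdeal K := h
        rwa [IsLocalRing.maximalIdeal_eq_bot] at h')
    have hle : P ≤ F := hP.le_of_le hF hsep.le
    exact fun x hx => hsep.eq_zero x (hle hx)
  let v := ValuationRing.valuation O K
  -- The invertible characters of `U_P` whose value at the generic point is not in `O`.
  let T : AddSubsemigroup (Module.Dual ℤ G) :=
    { carrier := {τ | (∀ x ∈ P.1, τ x = 0) ∧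
        ∃ h : τ ∈ dualCone P.1, 1 < v (φ (AddMonoidAlgebra.single ⟨τ, h⟩ 1))}
      add_mem' := by
        rintro τ τ' ⟨h, h1, h2⟩ ⟨h', h1', h2'⟩
        refine ⟨fun x hx => by simp [h x hx, h' x hx], add_mem h1 h1', ?_⟩
        have : AddMonoidAlgebra.single (⟨τ + τ', add_mem h1 h1'⟩ : dualCone P.1) (1 : R) =
            AddMonoidAlgebra.single ⟨τ, h1⟩ 1 * AddMonoidAlgebra.single ⟨τ', h1'⟩ 1 := by
          rw [AddMonoidAlgebra.single_mul_single, one_mul]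
          rfl
        rw [this, map_mul, map_mul]
        exact one_lt_mul'' h2 h2' }
  have h0 : (0 : Module.Dual ℤ G) ∉ T := by
    rintro ⟨-, h, h'⟩
    have : AddMonoidAlgebra.single (⟨0, h⟩ : dualCone P.1) (1 : R) = 1 := rfl
    rw [this, map_one, map_one] at h'
    exact lt_irrefl _ h'
  obtain ⟨Q, hQ, hPQ, hQT⟩ := Δ.exists_le_forall_notMem hfin hcomp P.2 T h0 fun τ hτ => hτ.1
  have hwφ : φ.comp (algebraMap R _) = (algebraMap O K).comp (Spec.preimage i₂).hom := by
    rw [Category.assoc, affineChart_toricSchemeToSpec] at w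
    have : CommRingCat.ofHom (algebraMap R (AddMonoidAlgebra R (dualCone P.1))) ≫
        CommRingCat.ofHom φ = Spec.preimage i₂ ≫ CommRingCat.ofHom (algebraMap O K) := by
      apply Spec.map_injective
      rw [Spec.map_comp, Spec.map_comp, Spec.map_preimage, w]
    exact congrArg CommRingCat.Hom.hom this
  have halg : (chartRingHom R hPQ).comp (algebraMap R _) = algebraMap R _ :=
    AddMonoidAlgebra.mapDomainRingHom_comp_algebraMap ..
  obtain ⟨ψ, hψ⟩ := exists_algebraMap_comp_eq hinj (φ.comp (chartRingHom R hPQ))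
    (AddMonoidAlgebra.map_mem_of_single _ _
      (fun r => ⟨(Spec.preimage i₂).hom r, by
        have h1 := RingHom.congr_fun hwφ r
        have h2 := RingHom.congr_fun halg r
        simp only [RingHom.comp_apply] at h1 h2 ⊢
        rw [h2, h1]⟩)
      (fun τ => by
        rw [RingHom.comp_apply, chartRingHom_single]
        have hτ : v (φ (AddMonoidAlgebra.single
            (AddSubmonoid.inclusion (dualCone_anti hPQ) τ) 1)) ≤ 1 := by
          by_contra hlt
          rw [not_le] at hlt
          refine hQT τ.1 τ.2 ⟨hvan (AddSubmonoid.inclusion (dualCone_anti hPQ) τ) fun h => ?_, _, hlt⟩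
          rw [h, map_zero] at hlt
          exact not_lt_zero hlt
        exact (ValuationRing.mem_integer_iff O K _).1 hτ))
  refine ⟨⟨⟨Spec.map (CommRingCat.ofHom ψ) ≫ affineChart R Δ ⟨Q, hQ⟩, ?_, ?_⟩⟩⟩
  · rw [← Category.assoc, ← Spec.map_comp, ← CommRingCat.ofHom_comp, hψ, CommRingCat.ofHom_comp,
      Spec.map_comp, Category.assoc, SpecMap_chartRingHom_affineChart R Δ (Q := P) (P := ⟨Q, hQ⟩)]
  · rw [Category.assoc, affineChart_toricSchemeToSpec, ← Spec.map_comp, ← CommRingCat.ofHom_comp]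
    have : ψ.comp (algebraMap R _) = (Spec.preimage i₂).hom := RingHom.ext fun r => hinj (by
      have h1 := RingHom.congr_fun hwφ r
      have h2 := RingHom.congr_fun halg r
      have h3 := RingHom.congr_fun hψ (algebraMap R _ r)
      simp only [RingHom.comp_apply] at h1 h2 h3 ⊢
      rw [h3, h2, h1])
    rw [this, CommRingCat.ofHom_hom, Spec.map_preimage]

/-! ### Properness forces the fan to be finite and complete -/

/-- The distinguished point of `U_P` lies only in the charts `U_Q` with `P ⊆ Q`. -/
theorem le_of_distinguishedPoint_mem {k : Type u} [Field k] [Algebra R k] {Δ : Fan G}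
    {P Q : Δ.cones} (h : affineChart R Δ P (Spec.map (CommRingCat.ofHom
      (distinguishedPoint k P.1 : AddMonoidAlgebra R (dualCone P.1) →ₐ[R] k).toRingHom)
        (IsLocalRing.closedPoint k)) ∈ Set.range (affineChart R Δ Q)) : P.1 ≤ Q.1 := by
  let L : Δ.cones := ⟨P.1 ⊓ Q.1, Δ.inf_mem P.2 Q.2⟩
  obtain ⟨σ, hσ⟩ := Δ.exists_separates P.2 L.2 inf_le_left
  have h1 := (range_affineChart_inter R Δ P Q).subset ⟨⟨_, rfl⟩, h⟩
  have h2 := (affineChart_mem_range_iff (F := L) hσ _).1 h1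
  have h3 : distinguishedPoint k P.1
      (AddMonoidAlgebra.single (⟨σ, hσ.mem_dualCone⟩ : dualCone P.1) (1 : R)) ≠ 0 := by
    intro h3
    apply h2
    change distinguishedPoint k P.1 _ ∈ IsLocalRing.maximalIdeal k
    rw [h3]
    exact zero_mem _
  rw [distinguishedPoint_single] at h3
  have h4 : ∀ x ∈ P.1, σ x = 0 := by
    by_contra hc
    exact h3 (if_neg hc)
  intro x hx
  by_contra hxQ
  exact (hσ.pos x hx fun hL => hxQ hL.2).ne' (h4 x hx)

variable (R) in
/-- Quasi-compactness gives finitely many charts covering the toric scheme. By the distinguished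
points every cone is contained in one of the corresponding cones. -/
theorem Fan.isFinite_of_quasiCompact [Nontrivial R] (Δ : Fan G)
    [QuasiCompact (toricSchemeToSpec R Δ)] : Δ.IsFinite := by
  obtain ⟨m, hm⟩ := Ideal.exists_maximal R
  let _ : Field (R ⧸ m) := Ideal.Quotient.field m
  have : CompactSpace (toricScheme R Δ) :=
    QuasiCompact.compactSpace_of_compactSpace (toricSchemeToSpec R Δ)
  obtain ⟨t, ht⟩ := isCompact_univ.elim_finite_subcover
    (fun P : Δ.cones => Set.range (affineChart R Δ P))
    (fun P => (affineChart R Δ P).isOpenEmbedding.isOpen_range)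
    (fun x _ => Set.mem_iUnion.2 (affineChart_jointly_surjective R Δ x))
  refine (t.finite_toSet.biUnion fun Q _ => Δ.finite_setOf_le Q.2).subset fun P hP => ?_
  obtain ⟨Q, hQ, h⟩ := Set.mem_iUnion₂.1 (ht (Set.mem_univ (affineChart R Δ ⟨P, hP⟩
    (Spec.map (CommRingCat.ofHom
      (distinguishedPoint (R ⧸ m) P : AddMonoidAlgebra R (dualCone P) →ₐ[R] R ⧸ m).toRingHom)
        (IsLocalRing.closedPoint (R ⧸ m))))))
  exact Set.mem_biUnion (Finset.mem_coe.2 hQ)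
    ⟨hP, le_of_distinguishedPoint_mem (P := ⟨P, hP⟩) h⟩

variable (R) in
/-- If the one-parameter subgroup attached to `x`, viewed as a point with values in the Laurent
series over a residue field of `R`, has a limit, then the limit lies in some `U_P`, and integrality
of `X ^ σ(x)` for all `σ ∈ P^∨` means that `x ∈ P`. -/
theorem Fan.isComplete_of_existence [Nontrivial R] (Δ : Fan G)
    (hex : ValuativeCriterion.Existence (toricSchemeToSpec R Δ)) : Δ.IsComplete := by
  refine Set.eq_univ_of_forall fun x => ?_
  obtain ⟨m, hm⟩ := Ideal.exists_maximal R
  let _ : Field (R ⧸ m) := Ideal.Quotient.field m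
  let O := PowerSeries (R ⧸ m)
  let K := LaurentSeries (R ⧸ m)
  let _ : Algebra R K := ((algebraMap O K).comp (algebraMap R O)).toAlgebra
  have hinj := IsFractionRing.injective O K
  have ht : algebraMap O K PowerSeries.X ≠ 0 := by
    rw [Ne, map_eq_zero_iff _ hinj]
    exact PowerSeries.X_ne_zero
  let B : Δ.cones := ⟨⊥, Δ.bot_mem⟩
  let θ : AddMonoidAlgebra R (dualCone B.1) →ₐ[R] K := oneParameterSubgroup B.1 ht x
  have w : (Spec.map (CommRingCat.ofHom θ.toRingHom) ≫ affineChart R Δ B) ≫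
      toricSchemeToSpec R Δ = Spec.map (CommRingCat.ofHom (algebraMap O K)) ≫
        Spec.map (CommRingCat.ofHom (algebraMap R O)) := by
    rw [Category.assoc, affineChart_toricSchemeToSpec, ← Spec.map_comp, ← Spec.map_comp,
      ← CommRingCat.ofHom_comp, ← CommRingCat.ofHom_comp]
    congr 2
    exact θ.comp_algebraMap
  obtain ⟨l, hl, -⟩ := (hex { R := O, K := K, commSq := ⟨w⟩, .. }).exists_lift
  dsimp only at l hl
  obtain ⟨P, hP⟩ := affineChart_jointly_surjective R Δ (l (IsLocalRing.closedPoint O))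
  obtain ⟨ψ, rfl⟩ := exists_eq_SpecMap_affineChart l hP
  refine Set.mem_biUnion P.2 ((Δ.isConvexCone P.1 P.2).mem_of_forall_dualCone fun σ hσ => ?_)
  have hBP : B.1 ≤ P.1 := bot_le
  have h1 : (algebraMap O K).comp ψ = θ.toRingHom.comp (chartRingHom R hBP) := by
    apply SpecMap_affineChart_injective
    simpa [SpecMap_chartRingHom_affineChart] using hl
  have h2 := RingHom.congr_fun h1 (AddMonoidAlgebra.single ⟨σ, hσ⟩ 1)
  rw [RingHom.comp_apply, RingHom.comp_apply, chartRingHom_single] at h2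
  have h3 := h2.trans (oneParameterSubgroup_single ht x _)
  change _ = _ ^ (σ x) at h3
  by_contra hneg
  obtain ⟨n, hn⟩ := Int.eq_ofNat_of_zero_le (a := -σ x) (by omega)
  have h4 : ψ (AddMonoidAlgebra.single ⟨σ, hσ⟩ 1) * PowerSeries.X ^ n = 1 := hinj (by
    rw [map_mul, h3, map_pow, map_one, ← zpow_natCast, ← zpow_add₀ ht]
    have : σ x + (n : ℤ) = 0 := by omega
    rw [this, zpow_zero])
  have h5 : IsUnit ((PowerSeries.X : O) ^ n) := IsUnit.of_mul_eq_one_right _ h4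
  rw [isUnit_pow_iff (by omega)] at h5
  exact PowerSeries.X_prime.not_isUnit h5

end Schemes

end ToricScheme

theorem mainTheorem1 {R : Type u} [CommRing R] [Nontrivial R]
    {G : Type u} [AddCommGroup G] [Module.Free ℤ G] [Module.Finite ℤ G]
    (Δ : ToricScheme.Fan G) :
    IsProper (ToricScheme.toricSchemeToSpec R Δ) ↔ Δ.IsFinite ∧ Δ.IsComplete := by
  constructor
  · intro h
    rw [IsProper.eq_valuativeCriterion] at h
    obtain ⟨⟨⟨hval, hqc⟩, -⟩, -⟩ := h
    have : QuasiCompact (ToricScheme.toricSchemeToSpec R Δ) := hqc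
    exact ⟨Δ.isFinite_of_quasiCompact R, Δ.isComplete_of_existence R hval.existence⟩
  · rintro ⟨hfin, hcomp⟩
    have := ToricScheme.quasiCompact_toricSchemeToSpec R hfin
    have := ToricScheme.quasiSeparated_toricSchemeToSpec R Δ
    have := ToricScheme.locallyOfFiniteType_toricSchemeToSpec R Δ
    exact IsProper.of_valuativeCriterion _ (ValuativeCriterion.iff.2
      ⟨ToricScheme.toricSchemeToSpec_existence hfin hcomp,
        ToricScheme.toricSchemeToSpec_uniqueness Δ⟩)
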